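/- Let $\mathcal H$ be a complex Hilbert space, $U$ a unitary operator on $\mathcal H$, $k\ge 1$, and $\alpha:\{1,\dots,2k\}\to\{1,\dots,k\}$ a pair-partition, i.e. a map for which each $\alpha^{-1}(\{j\})$, $1\le j\le k$, has exactly two elements. Let $A_1,\dots,A_{2k-1}$ be compact operators on $\mathcal H$. Put $$\sigma_{pp}(U)=\{z\in\mathbb C : |z|=1,\ z\text{ is an eigenvalue of }U\},\qquad \sigma^a_{pp}(U)=\{z\in\sigma_{pp}(U) : zw=1\text{ for some }w\in\sigma_{pp}(U)\},$$ let $E_z$ be the selfadjoint projection onto the eigenspace of $U$ at $z$, and for $z_1,\dots,z_k\in\sigma^a_{pp}(U)$ and $1\le i\le 2k$ with $\alpha(i)=j$ let $z^\#_{\alpha(i)}=z_j$ if $i$ is the smaller element of $\alpha^{-1}(\{j\})$ and $z^\#_{\alpha(i)}=\bar z_j$ if it is the larger one. For finite $F\subset\sigma^a_{pp}(U)$ put $$S^F_{\alpha;A_1,\dots,A_{2k-1}}=\sum_{z_1,\dots,z_k\in F}E_{z^\#_{\alpha(1)}}A_1E_{z^\#_{\alpha(2)}}\cdots E_{z^\#_{\alpha(2k-1)}}A_{2k-1}E_{z^\#_{\alpha(2k)}}.$$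 Then the net $(S^F_{\alpha;A_1,\dots,A_{2k-1}})_F$, indexed by the finite subsets $F$ of $\sigma^a_{pp}(U)$ ordered by inclusion, converges in the weak operator topology to a bounded operator $S_{\alpha;A_1,\dots,A_{2k-1}}$, written symbolically $\sum_{z_1,\dots,z_k\in\sigma^a_{pp}(U)}E_{z^\#_{\alpha(1)}}A_1E_{z^\#_{\alpha(2)}}\cdots A_{2k-1}E_{z^\#_{\alpha(2k)}}$, and, as $N\to\infty$, $$\frac1{N^k}\sum_{n_1,\dots,n_k=0}^{N-1}U^{n_{\alpha(1)}}A_1U^{n_{\alpha(2)}}\cdots U^{n_{\alpha(2k-1)}}A_{2k-1}U^{n_{\alpha(2k)}}\longrightarrow S_{\alpha;A_1,\dots,A_{2k-1}}$$ in the weak operator topology. -/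

import Mathlib

open Filter Topology

/-- The alternating product `V₁ A₁ V₂ A₂ ⋯ A_{m-1} V_m` (indices shifted to start at `0`). -/
def alternatingProd {M : Type*} [Monoid M] {m : ℕ} (V : Fin m → M) (A : Fin (m - 1) → M) : M :=
  (List.ofFn fun i : Fin m => V i * (if h : (i : ℕ) < m - 1 then A ⟨i, h⟩ else 1)).prod

/-- A pair-partition of a set with `2k` elements into `k` pairs: each of the `k` parts
`α⁻¹({j})` has exactly two elements. -/
def IsPairPartition {k : ℕ} (α : Fin (2 * k) → Fin k) : Prop :=
  ∀ j : Fin k, (Finset.univ.filter fun i => α i = j).card = 2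

section

variable {H : Type*} [NormedAddCommGroup H] [InnerProductSpace ℂ H]

/-- The eigenvalues of `U` on the unit circle. -/
def sigmaPP (U : H →L[ℂ] H) : Set ℂ :=
  {z | ‖z‖ = 1 ∧ Module.End.HasEigenvalue (U : Module.End ℂ H) z}

/-- The eigenvalues of `U` whose inverse is an eigenvalue too. -/
def sigmaPPA (U : H →L[ℂ] H) : Set ℂ :=
  {z | z ∈ sigmaPP U ∧ ∃ w ∈ sigmaPP U, z * w = 1}

/-- The multiple Cesàro mean
`N^{-k} ∑_{0 ≤ n₁,…,n_k ≤ N-1} U^{n_{α(1)}} A₁ U^{n_{α(2)}} ⋯ A_{2k-1} U^{n_{α(2k)}}`. -/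
noncomputable def entangledMean (U : H →L[ℂ] H) {k : ℕ} (α : Fin (2 * k) → Fin k)
    (A : Fin (2 * k - 1) → H →L[ℂ] H) (N : ℕ) : H →L[ℂ] H :=
  ((N : ℂ) ^ k)⁻¹ • ∑ n ∈ Fintype.piFinset (fun _ : Fin k => Finset.range N),
    alternatingProd (fun i => U ^ n (α i)) A

/-- The value attached to position `i`: `z_j` if `i` is the first element of its pair
`α⁻¹({j})`, and the conjugate of `z_j` if it is the second one. -/
noncomputable def zSharp {k : ℕ} (α : Fin (2 * k) → Fin k) (z : Fin k → ℂ) (i : Fin (2 * k)) : ℂ :=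
  if ∃ i' < i, α i' = α i then starRingEnd ℂ (z (α i)) else z (α i)

theorem isClosed_eigenspace_clm (U : H →L[ℂ] H) (z : ℂ) :
    IsClosed (Module.End.eigenspace (U : Module.End ℂ H) z : Set H) := by
  have h : (Module.End.eigenspace (U : Module.End ℂ H) z : Set H) = {x | U x = z • x} := by
    ext x
    simp
  rw [h]
  exact isClosed_eq U.continuous (continuous_const_smul z)

variable [CompleteSpace H]

instance eigenspace_clm_hasOrthogonalProjection (U : H →L[ℂ] H) (z : ℂ) :
    (Module.End.eigenspace (U : Module.End ℂ H) z).HasOrthogonalProjection :=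
  haveI : CompleteSpace (Module.End.eigenspace (U : Module.End ℂ H) z) :=
    (isClosed_eigenspace_clm U z).completeSpace_coe
  inferInstance

/-- The selfadjoint projection `E_z` of `H` onto the eigenspace of `U` at `z`. -/
noncomputable def eigenProj (U : H →L[ℂ] H) (z : ℂ) : H →L[ℂ] H :=
  (Module.End.eigenspace (U : Module.End ℂ H) z).starProjection

/-- For a finite set `F` of eigenvalues with inverse an eigenvalue, the finite sum
`∑_{z₁,…,z_k ∈ F} E_{z^#_{α(1)}} A₁ E_{z^#_{α(2)}} ⋯ A_{2k-1} E_{z^#_{α(2k)}}`. -/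
noncomputable def entangledPartialSum (U : H →L[ℂ] H) {k : ℕ} (α : Fin (2 * k) → Fin k)
    (A : Fin (2 * k - 1) → H →L[ℂ] H) (F : Finset (sigmaPPA U)) : H →L[ℂ] H :=
  ∑ z ∈ Fintype.piFinset (fun _ : Fin k => F),
    alternatingProd (fun i => eigenProj U (zSharp α (fun j => (z j : ℂ)) i)) A

end

/-! For rank-one $A_i$ the matrix element at $x,y$ of an entangled sum factors over the pairs
(`inner_entangledSum_eq_prod`), which leaves averages $\frac1N\sum_n\langle u,U^nv\rangle\langle
u',U^nv'\rangle$ (`exists_tendsto_average_inner_mul_inner`). If $Uv=zv$, the mean ergodic theorem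
produces $E_{\bar z}v'$ in the second factor, which is the $z$-term of the eigenvalue sum. If $v$ is
orthogonal to all eigenvectors, its spectral measure has no atoms and Wiener's lemma gives the limit
$0$. Such $v$ span a dense subspace.

Compact operators are norm limits of finite-rank ones, so multilinearity extends convergence to all
compact $A_i$ once the matrix elements are bounded by $\|x\|\|y\|\prod\|A_i\|$. For the means this
is immediate. For the partial sums it is the crux (`norm_inner_entangledPartialSum_le`): with
$P_i=\sum_{w\in F}E_{w^\#}$ at position $i$, the partial sum over $F$ is the limit of the entangled
means of the contractions $P_iU^n$, and so inherits their bound.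

Whenever two families must share a limit, they are indexed by a sum type and one limit is taken
along the supremum of the two filters. -/

/-! ### Extending convergence from a set to its closed linear span -/

section LimitExtension

variable {κ E : Type*} [NormedAddCommGroup E] [NormedSpace ℂ E]

/-- An $\varepsilon/4$ argument. The bound is asked only on the closed span because the partial sums
are controlled uniformly only there. -/
theorem exists_tendsto_of_mem_closure_span {l : Filter κ} [l.NeBot] (T : κ → E →ₗ[ℂ] ℂ) (R : Set E)
    (C : ℝ) (hb : ∀ i, ∀ v ∈ (Submodule.span ℂ R).topologicalClosure, ‖T i v‖ ≤ C * ‖v‖)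
    (hR : ∀ v ∈ R, ∃ c, Tendsto (fun i => T i v) l (𝓝 c))
    {v : E} (hv : v ∈ (Submodule.span ℂ R).topologicalClosure) :
    ∃ c, Tendsto (fun i => T i v) l (𝓝 c) := by
  have hspan : ∀ w ∈ Submodule.span ℂ R, ∃ c, Tendsto (fun i => T i w) l (𝓝 c) := by
    intro w hw
    induction hw using Submodule.span_induction with
    | mem x hx => exact hR x hx
    | zero => exact ⟨0, by simp⟩
    | add x y _ _ hx hy =>
      obtain ⟨c, hc⟩ := hx
      obtain ⟨d, hd⟩ := hy
      exact ⟨c + d, by simpa using hc.add hd⟩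
    | smul a x _ hx =>
      obtain ⟨c, hc⟩ := hx
      exact ⟨a * c, by simpa using hc.const_mul a⟩
  have hcauchy : Cauchy (map (fun i => T i v) l) := by
    rw [Metric.cauchy_iff]
    refine ⟨inferInstance, fun ε hε => ?_⟩
    -- `C` has no assumed sign; `|C| + 1` is a positive substitute.
    have hC : 0 < |C| + 1 := by positivity
    obtain ⟨w, hw, hvw⟩ := Metric.mem_closure_iff.1 hv (ε / (4 * (|C| + 1))) (by positivity)
    obtain ⟨c, hc⟩ := hspan w hw
    have hclose : ∀ i, dist (T i v) (T i w) ≤ ε / 4 := by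
      intro i
      rw [dist_eq_norm, ← map_sub]
      calc ‖T i (v - w)‖ ≤ C * ‖v - w‖ :=
            hb i _ (Submodule.sub_mem _ hv (Submodule.le_topologicalClosure _ hw))
        _ ≤ (|C| + 1) * (ε / (4 * (|C| + 1))) := by
            rw [← dist_eq_norm]
            exact mul_le_mul ((le_abs_self C).trans (by linarith)) hvw.le dist_nonneg hC.le
        _ = ε / 4 := by field_simp
    refine ⟨(fun i => T i v) '' {i | dist (T i w) c < ε / 4},
      image_mem_map (hc (Metric.ball_mem_nhds c (by positivity))), ?_⟩
    rintro _ ⟨i, hi, rfl⟩ _ ⟨j, hj, rfl⟩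
    have h1 := hclose i
    have h2 := hclose j
    have h3 := dist_triangle4 (T i v) (T i w) (T j w) (T j v)
    have h4 := dist_triangle_right (T i w) (T j w) c
    rw [dist_comm (T j w) (T j v)] at h3
    simp only [Set.mem_ofPred_eq] at hi hj
    linarith
  obtain ⟨c, hc⟩ := CompleteSpace.complete hcauchy
  exact ⟨c, hc⟩

theorem MultilinearMap.exists_tendsto_of_mem_closure_span {l : Filter κ} [l.NeBot]
    {ι : Type*} [Fintype ι] [DecidableEq ι]
    (T : κ → MultilinearMap ℂ (fun _ : ι => E) ℂ) (R : Set E) (C : ℝ)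
    (hb : ∀ i (A : ι → E), (∀ j, A j ∈ (Submodule.span ℂ R).topologicalClosure) →
      ‖T i A‖ ≤ C * ∏ j, ‖A j‖)
    (hR : ∀ A : ι → E, (∀ j, A j ∈ R) → ∃ c, Tendsto (fun i => T i A) l (𝓝 c))
    {A : ι → E} (hA : ∀ j, A j ∈ (Submodule.span ℂ R).topologicalClosure) :
    ∃ c, Tendsto (fun i => T i A) l (𝓝 c) := by
  have hRW : R ⊆ (Submodule.span ℂ R).topologicalClosure :=
    Submodule.subset_span.trans (Submodule.le_topologicalClosure _)
  -- The slots are freed from `R` one at a time; `s` is the set of slots already allowed in the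
  -- closed span.
  suffices H : ∀ (s : Finset ι) (A : ι → E),
      (∀ j ∈ s, A j ∈ (Submodule.span ℂ R).topologicalClosure) → (∀ j ∉ s, A j ∈ R) →
      ∃ c, Tendsto (fun i => T i A) l (𝓝 c) from
    H Finset.univ A (fun j _ => hA j) (fun j hj => absurd (Finset.mem_univ j) hj)
  intro s
  induction s using Finset.induction_on with
  | empty => exact fun A _ h => hR A fun j => h j (by simp)
  | insert a s ha ih =>
    intro A hW hAR
    have hmem : ∀ j, A j ∈ (Submodule.span ℂ R).topologicalClosure := fun j => by
      by_cases hj : j ∈ insert a s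
      · exact hW j hj
      · exact hRW (hAR j hj)
    have := _root_.exists_tendsto_of_mem_closure_span (l := l) (fun i => (T i).toLinearMap A a) R
      (C * ∏ j ∈ Finset.univ.erase a, ‖A j‖) ?_ ?_ (hmem a)
    · simpa using this
    · intro i v hv
      have hbi := hb i (Function.update A a v) (fun j => by
        by_cases hj : j = a
        · subst hj; simpa using hv
        · simpa [hj] using hmem j)
      rw [← Finset.mul_prod_erase _ _ (Finset.mem_univ a)] at hbi
      simp only [Function.update_self] at hbi
      rw [Finset.prod_congr rfl (g := fun j => ‖A j‖) (fun j hj => by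
        rw [Function.update_of_ne (Finset.ne_of_mem_erase hj)])] at hbi
      simpa [mul_assoc, mul_comm, mul_left_comm] using hbi
    · intro v hv
      refine ih (Function.update A a v) (fun j hj => ?_) (fun j hj => ?_)
      · rw [Function.update_of_ne (ne_of_mem_of_not_mem hj ha)]
        exact hW j (Finset.mem_insert_of_mem hj)
      · by_cases hja : j = a
        · subst hja; simpa using hv
        · rw [Function.update_of_ne hja]
          exact hAR j (by simp [hja, hj])

end LimitExtension

/-! ### Finite-rank approximation and weak operator limits -/

section HilbertSpace

variable {H : Type*} [NormedAddCommGroup H] [InnerProductSpace ℂ H]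

/-- The rank-one operators `x ↦ ⟪b, x⟫ a`. -/
def rankOneOperators (H : Type*) [NormedAddCommGroup H] [InnerProductSpace ℂ H] :
    Set (H →L[ℂ] H) :=
  {B | ∃ a b : H, InnerProductSpace.rankOne ℂ a b = B}

variable [CompleteSpace H]

/-- The image of the unit ball has a finite $\varepsilon/2$-net; projecting onto the span of the net
moves no image point by more than $\varepsilon/2$. -/
theorem IsCompactOperator.mem_closure_span_rankOneOperators {T : H →L[ℂ] H}
    (hT : IsCompactOperator T) :
    T ∈ (Submodule.span ℂ (rankOneOperators H)).topologicalClosure := by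
  refine Metric.mem_closure_iff.2 fun ε hε => ?_
  have htb : TotallyBounded (T '' Metric.closedBall 0 1) :=
    (hT.isCompact_closure_image_closedBall (𝕜₁ := ℂ) (𝕜₂ := ℂ) (σ₁₂ := RingHom.id ℂ)
      (f := (T : H →ₗ[ℂ] H)) 1).totallyBounded.subset subset_closure
  obtain ⟨t, ht, hcov⟩ := Metric.totallyBounded_iff.1 htb (ε / 2) (by positivity)
  let K : Submodule ℂ H := Submodule.span ℂ t
  have : FiniteDimensional ℂ K := FiniteDimensional.span_of_finite ℂ ht
  let e := stdOrthonormalBasis ℂ K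
  refine ⟨K.starProjection ∘L T, ?_, ?_⟩
  · have : K.starProjection ∘L T =
        ∑ i, InnerProductSpace.rankOne ℂ (e i : H) (T.adjoint (e i)) := by
      rw [e.starProjection_eq_sum_rankOne, ContinuousLinearMap.finsetSum_comp]
      simp [InnerProductSpace.rankOne_comp]
    rw [this]
    exact Submodule.sum_mem _ fun i _ => Submodule.subset_span ⟨_, _, rfl⟩
  · rw [dist_eq_norm]
    refine lt_of_le_of_lt (ContinuousLinearMap.opNorm_le_of_unit_norm (C := ε / 2)
      (by positivity) fun x hx => ?_) (by linarith)
    have hmem : T x ∈ ⋃ y ∈ t, Metric.ball y (ε / 2) := hcov ⟨x, by simp [hx], rfl⟩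
    simp only [Set.mem_iUnion, Metric.mem_ball, exists_prop] at hmem
    obtain ⟨y, hy, hxy⟩ := hmem
    have : ‖T x - K.starProjection (T x)‖ ≤ ‖T x - y‖ := by
      rw [K.starProjection_minimal (T x)]
      exact ciInf_le ⟨0, by rintro _ ⟨w, rfl⟩; exact norm_nonneg _⟩
        (⟨y, Submodule.subset_span hy⟩ : K)
    rw [dist_eq_norm] at hxy
    simpa using this.trans hxy.le

/-- The limits of the matrix elements form a bounded sesquilinear form, hence come from an operator.
-/
theorem exists_tendsto_wot {κ : Type*} {l : Filter κ} [l.NeBot] (T : κ → H →L[ℂ] H)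
    (C : ℝ) (hC : ∀ i x y, ‖inner ℂ x (T i y)‖ ≤ C * ‖x‖ * ‖y‖)
    (h : ∀ x y : H, ∃ c, Tendsto (fun i => inner ℂ x (T i y)) l (𝓝 c)) :
    ∃ S : H →L[ℂ] H, Tendsto (fun i => ContinuousLinearMapWOT.ofCLM (T i)) l
      (𝓝 (ContinuousLinearMapWOT.ofCLM S)) := by
  choose c hc using h
  have hlim : ∀ x y d, Tendsto (fun i => inner ℂ x (T i y)) l (𝓝 d) → c x y = d :=
    fun x y d hd => tendsto_nhds_unique (hc x y) hd
  let B : H →ₗ⋆[ℂ] H →ₗ[ℂ] ℂ := LinearMap.mk₂'ₛₗ (starRingEnd ℂ) (RingHom.id ℂ) c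
    (fun x x' y => hlim _ _ _ (by simpa [inner_add_left] using (hc x y).add (hc x' y)))
    (fun a x y => hlim _ _ _ (by simpa [inner_smul_left, mul_comm] using (hc x y).const_mul (starRingEnd ℂ a)))
    (fun x y y' => hlim _ _ _ (by simpa [inner_add_right] using (hc x y).add (hc x y')))
    (fun a x y => hlim _ _ _ (by simpa [inner_smul_right, mul_comm] using (hc x y).const_mul a))
  let B' : H →L⋆[ℂ] H →L[ℂ] ℂ := B.mkContinuous₂ C fun x y =>
    le_of_tendsto (hc x y).norm (Eventually.of_forall fun i => hC i x y)
  refine ⟨(InnerProductSpace.continuousLinearMapOfBilin B').adjoint, ?_⟩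
  rw [ContinuousLinearMapWOT.tendsto_iff_forall_inner_apply_tendsto]
  intro y x
  have : inner ℂ x ((InnerProductSpace.continuousLinearMapOfBilin B').adjoint y) = c x y := by
    rw [ContinuousLinearMap.adjoint_inner_right, InnerProductSpace.continuousLinearMapOfBilin_apply]
    rfl
  simpa [this] using hc x y

end HilbertSpace

/-! ### Cesàro averages of scalars -/

theorem norm_sub_one_mul_geom_sum_le {z : ℂ} (hz : ‖z‖ = 1) (N : ℕ) :
    ‖z - 1‖ * ‖∑ n ∈ Finset.range N, z ^ n‖ ≤ 2 := by
  rw [← norm_mul, mul_geom_sum]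
  refine (norm_sub_le _ _).trans ?_
  simp [hz]
  norm_num

theorem tendsto_average_pow {z : ℂ} (hz : ‖z‖ = 1) :
    Tendsto (fun N : ℕ => (N : ℂ)⁻¹ * ∑ n ∈ Finset.range N, z ^ n) atTop
      (𝓝 (if z = 1 then 1 else 0)) := by
  split_ifs with h
  · subst h
    refine tendsto_const_nhds.congr' ?_
    filter_upwards [eventually_ge_atTop 1] with N hN
    have : (N : ℂ) ≠ 0 := Nat.cast_ne_zero.2 (by lia)
    simp [this]
  · have hpos : 0 < ‖z - 1‖ := norm_pos_iff.2 (sub_ne_zero.2 h)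
    have hlim : Tendsto (fun N : ℕ => (N : ℝ)⁻¹ * (2 / ‖z - 1‖)) atTop (𝓝 0) := by
      simpa using tendsto_inv_atTop_nhds_zero_nat.mul_const (2 / ‖z - 1‖)
    refine squeeze_zero_norm (fun N => ?_) hlim
    rw [norm_mul, norm_inv, Complex.norm_natCast]
    gcongr
    rw [le_div_iff₀ hpos, mul_comm]
    exact norm_sub_one_mul_geom_sum_le hz N

theorem norm_average_le {f : ℕ → ℂ} {C : ℝ} (hC : 0 ≤ C) (hf : ∀ n, ‖f n‖ ≤ C) (N : ℕ) :
    ‖(N : ℂ)⁻¹ * ∑ n ∈ Finset.range N, f n‖ ≤ C := by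
  rcases Nat.eq_zero_or_pos N with rfl | hN
  · simpa using hC
  have hN' : (0 : ℝ) < N := by exact_mod_cast hN
  rw [norm_mul, norm_inv, Complex.norm_natCast, inv_mul_le_iff₀ hN']
  calc ‖∑ n ∈ Finset.range N, f n‖ ≤ ∑ n ∈ Finset.range N, C :=
        norm_sum_le_of_le _ fun n _ => hf n
    _ = N * C := by simp

theorem mem_eigenspace_clm {H : Type*} [NormedAddCommGroup H] [InnerProductSpace ℂ H]
    {U : H →L[ℂ] H} {z : ℂ} {x : H} :
    x ∈ Module.End.eigenspace (U : Module.End ℂ H) z ↔ U x = z • x := by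
  simp

/-! ### Eigenprojections of a unitary and the mean ergodic theorem -/

section

variable {H : Type*} [NormedAddCommGroup H] [InnerProductSpace ℂ H] [CompleteSpace H]
  {U : H →L[ℂ] H}

theorem norm_apply_of_mem_unitary (hU : U ∈ unitary (H →L[ℂ] H)) (x : H) : ‖U x‖ = ‖x‖ :=
  ContinuousLinearMap.norm_map_of_mem_unitary hU x

theorem norm_pow_apply_of_mem_unitary (hU : U ∈ unitary (H →L[ℂ] H)) (n : ℕ) (x : H) :
    ‖(U ^ n) x‖ = ‖x‖ :=
  ContinuousLinearMap.norm_map_of_mem_unitary (pow_mem hU n) x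

theorem apply_eigenProj (z : ℂ) (x : H) : U (eigenProj U z x) = z • eigenProj U z x :=
  mem_eigenspace_clm.1 (Submodule.starProjection_apply_mem _ x)

theorem eigenProj_apply_of_apply_eq {z : ℂ} {x : H} (h : U x = z • x) : eigenProj U z x = x :=
  Submodule.starProjection_eq_self_iff.2 (mem_eigenspace_clm.2 h)

theorem inner_eigenProj_left (z : ℂ) (x y : H) :
    inner ℂ (eigenProj U z x) y = inner ℂ x (eigenProj U z y) :=
  Submodule.inner_starProjection_left_eq_right _ x y

theorem eigenProj_eigenProj (z : ℂ) (x : H) :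
    eigenProj U z (eigenProj U z x) = eigenProj U z x :=
  eigenProj_apply_of_apply_eq (apply_eigenProj z x)

theorem inner_apply_apply_of_mem_unitary (hU : U ∈ unitary (H →L[ℂ] H)) (x y : H) :
    inner ℂ (U x) (U y) = inner ℂ x y :=
  ContinuousLinearMap.inner_map_map_of_mem_unitary hU x y

theorem norm_eq_one_of_apply_eq_smul (hU : U ∈ unitary (H →L[ℂ] H)) {z : ℂ} {x : H} (hx : x ≠ 0)
    (h : U x = z • x) : ‖z‖ = 1 := by
  have := norm_apply_of_mem_unitary hU x
  rw [h, norm_smul] at this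
  exact (mul_eq_right₀ (norm_ne_zero_iff.2 hx)).1 this

theorem conj_mul_eq_one_of_norm {z : ℂ} (hz : ‖z‖ = 1) : (starRingEnd ℂ) z * z = 1 := by
  rw [mul_comm, Complex.mul_conj, Complex.normSq_eq_norm_sq, hz]
  norm_num

theorem inner_eq_zero_of_apply_eq_smul (hU : U ∈ unitary (H →L[ℂ] H)) {z w : ℂ} (hzw : z ≠ w)
    {x y : H} (hx : U x = z • x) (hy : U y = w • y) : inner ℂ x y = 0 := by
  by_cases hx0 : x = 0
  · simp [hx0]
  have hz := norm_eq_one_of_apply_eq_smul hU hx0 hx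
  have h := inner_apply_apply_of_mem_unitary hU x y
  rw [hx, hy, inner_smul_left, inner_smul_right, ← mul_assoc] at h
  by_contra hne
  have h1 : (starRingEnd ℂ) z * w = 1 := (mul_eq_right₀ hne).1 h
  have h2 := conj_mul_eq_one_of_norm hz
  have hz0 : (starRingEnd ℂ) z ≠ 0 := left_ne_zero_of_mul_eq_one h2
  exact hzw (mul_left_cancel₀ hz0 (h2.trans h1.symm))

theorem eigenProj_apply_of_ne (hU : U ∈ unitary (H →L[ℂ] H)) {z w : ℂ} (hzw : z ≠ w) {x : H}
    (hx : U x = w • x) : eigenProj U z x = 0 := by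
  rw [← inner_self_eq_zero (𝕜 := ℂ), inner_eigenProj_left, eigenProj_eigenProj,
    ← inner_eigenProj_left]
  exact inner_eq_zero_of_apply_eq_smul hU hzw (apply_eigenProj z x) hx

theorem sum_norm_sq_eigenProj (hU : U ∈ unitary (H →L[ℂ] H)) (F : Finset ℂ) (x : H) :
    ∑ z ∈ F, ‖eigenProj U z x‖ ^ 2 = ‖∑ z ∈ F, eigenProj U z x‖ ^ 2 := by
  rw [← Complex.ofReal_inj]
  push_cast
  have h := inner_self_eq_norm_sq_to_K (𝕜 := ℂ) (∑ z ∈ F, eigenProj U z x)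
  refine Eq.trans ?_ h
  rw [sum_inner]
  refine Finset.sum_congr rfl fun z hz => ?_
  rw [inner_sum, Finset.sum_eq_single z]
  · exact (inner_self_eq_norm_sq_to_K (𝕜 := ℂ) (eigenProj U z x)).symm
  · intro w _ hw
    exact inner_eq_zero_of_apply_eq_smul hU hw.symm (apply_eigenProj z x) (apply_eigenProj w x)
  · exact fun h => absurd hz h

/-- Bessel's inequality: $\|Px\|^2=\langle Px,x\rangle\le\|Px\|\|x\|$ for $P=\sum_{z\in F}E_z$. -/
theorem norm_sum_eigenProj_apply_le (hU : U ∈ unitary (H →L[ℂ] H)) (F : Finset ℂ) (x : H) :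
    ‖∑ z ∈ F, eigenProj U z x‖ ≤ ‖x‖ := by
  have h1 : ‖∑ z ∈ F, eigenProj U z x‖ ^ 2 ≤ ‖∑ z ∈ F, eigenProj U z x‖ * ‖x‖ := by
    refine le_trans (le_of_eq ?_) (norm_inner_le_norm (𝕜 := ℂ) (∑ z ∈ F, eigenProj U z x) x)
    have : inner ℂ (∑ z ∈ F, eigenProj U z x) x = ((∑ z ∈ F, ‖eigenProj U z x‖ ^ 2 : ℝ) : ℂ) := by
      push_cast
      rw [sum_inner]
      refine Finset.sum_congr rfl fun z _ => ?_
      rw [← eigenProj_eigenProj, inner_eigenProj_left, eigenProj_eigenProj]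
      exact inner_self_eq_norm_sq_to_K (𝕜 := ℂ) (eigenProj U z x)
    rw [this, sum_norm_sq_eigenProj hU, Complex.norm_real, Real.norm_of_nonneg (by positivity)]
  rcases eq_or_ne (‖∑ z ∈ F, eigenProj U z x‖) 0 with h0 | h0
  · rw [h0]; positivity
  · have : 0 < ‖∑ z ∈ F, eigenProj U z x‖ := lt_of_le_of_ne (norm_nonneg _) h0.symm
    nlinarith

/-- **Mean ergodic theorem** for the operator `conj z • U`. -/
theorem tendsto_average_conj_pow_smul (hU : U ∈ unitary (H →L[ℂ] H)) {z : ℂ} (hz : ‖z‖ = 1)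
    (x : H) :
    Tendsto (fun N : ℕ => (N : ℂ)⁻¹ • ∑ n ∈ Finset.range N,
      (starRingEnd ℂ) z ^ n • (U ^ n) x) atTop (𝓝 (eigenProj U z x)) := by
  have hnorm : ‖(starRingEnd ℂ) z • U‖ ≤ 1 := by
    refine ContinuousLinearMap.opNorm_le_bound _ zero_le_one fun y => ?_
    simp [norm_smul, hz, norm_apply_of_mem_unitary hU]
  have h := ContinuousLinearMap.tendsto_birkhoffAverage_orthogonalProjection _ hnorm x
  have hK : ((starRingEnd ℂ) z • U).eqLocus (1 : H →L[ℂ] H) =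
      Module.End.eigenspace (U : Module.End ℂ H) z := by
    ext y
    rw [mem_eigenspace_clm]
    have hc := conj_mul_eq_one_of_norm hz
    change (starRingEnd ℂ) z • U y = y ↔ _
    constructor
    · intro hy
      nth_rw 2 [← hy]
      rw [smul_smul, mul_comm, hc, one_smul]
    · intro hy
      rw [hy, smul_smul, hc, one_smul]
  -- Stated for arbitrary subspaces and instances, so that the equality `hK` can be substituted
  -- despite the dependent types.
  have hproj : ∀ (K L : Submodule ℂ H) [K.HasOrthogonalProjection] [L.HasOrthogonalProjection],
      K = L → ((K.orthogonalProjectionOnto x : K) : H) = L.starProjection x := by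
    intro K L _ _ h
    subst h
    rfl
  rw [hproj _ _ hK] at h
  refine h.congr fun N => ?_
  simp only [birkhoffAverage, birkhoffSum, id]
  congr 1
  refine Finset.sum_congr rfl fun n _ => ?_
  rw [← FunLike.coe_pow_eq_iterate, smul_pow]
  rfl

end

/-! ### Spectral measure of a vector -/

section

variable {H : Type*} [NormedAddCommGroup H] [InnerProductSpace ℂ H] [CompleteSpace H]
  {U : H →L[ℂ] H}

/-- The continuous complex-valued function underlying a compactly supported real-valued one. -/
noncomputable def CompactlySupportedContinuousMap.complexify {X : Type*} [TopologicalSpace X]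
    (f : CompactlySupportedContinuousMap X ℝ) : C(X, ℂ) :=
  ⟨fun x => (f x : ℂ), Complex.continuous_ofReal.comp f.continuous⟩

/-- With $h=\sqrt g$ one has $f=\bar hh$, so the matrix element is the squared norm of $h(U)v$. -/
theorem inner_cfcHom_nonneg [hN : IsStarNormal U] (v : H) (f : C(spectrum ℂ U, ℂ))
    (g : C(spectrum ℂ U, ℝ)) (hfg : ∀ x, f x = ((g x : ℝ) : ℂ)) (hg : ∀ x, 0 ≤ g x) :
    0 ≤ (inner ℂ v (cfcHom (R := ℂ) (p := IsStarNormal) hN f v)).re := by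
  let h : C(spectrum ℂ U, ℂ) := ⟨fun x => ((Real.sqrt (g x) : ℝ) : ℂ), by fun_prop⟩
  have hf : f = star h * h := by
    ext x
    rw [hfg, ContinuousMap.mul_apply, ContinuousMap.star_apply]
    change _ = star ((Real.sqrt (g x) : ℝ) : ℂ) * ((Real.sqrt (g x) : ℝ) : ℂ)
    rw [Complex.star_def, Complex.conj_ofReal, ← Complex.ofReal_mul, Real.mul_self_sqrt (hg x)]
  rw [hf, map_mul, map_star, ContinuousLinearMap.star_eq_adjoint, mul_apply_eq_comp,
    ContinuousLinearMap.adjoint_inner_right]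
  exact inner_self_nonneg (𝕜 := ℂ)

theorem inner_cfcHom_ofReal_im [hN : IsStarNormal U] (v : H) (f : C(spectrum ℂ U, ℂ))
    (g : C(spectrum ℂ U, ℝ)) (hfg : ∀ x, f x = ((g x : ℝ) : ℂ)) :
    (inner ℂ v (cfcHom (R := ℂ) (p := IsStarNormal) hN f v)).im = 0 := by
  have hf : star f = f := by
    ext x
    rw [ContinuousMap.star_apply, hfg, Complex.star_def, Complex.conj_ofReal]
  have hs : star (cfcHom (R := ℂ) (p := IsStarNormal) hN f) =
      cfcHom (R := ℂ) (p := IsStarNormal) hN f := by rw [← map_star, hf]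
  rw [← Complex.conj_eq_iff_im, inner_conj_symm, ← ContinuousLinearMap.adjoint_inner_right,
    ← ContinuousLinearMap.star_eq_adjoint, hs]

/-- The **spectral measure** of a vector with respect to a normal operator. -/
theorem exists_measure_inner_pow_eq_integral [hN : IsStarNormal U] (v : H) :
    ∃ μ : MeasureTheory.Measure (spectrum ℂ U), MeasureTheory.IsFiniteMeasure μ ∧
      ∀ n : ℕ, inner ℂ v ((U ^ n) v) = ∫ z, (z : ℂ) ^ n ∂μ := by
  let Φ := cfcHom (R := ℂ) (p := IsStarNormal) hN
  -- $f\mapsto\operatorname{Re}\langle v,f(U)v\rangle$ is positive on real functions; Riesz–Markov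
  -- yields the measure. Complex functions are recovered from real and imaginary parts.
  let L : CompactlySupportedContinuousMap (spectrum ℂ U) ℝ →ₗ[ℝ] ℝ :=
    { toFun f := (inner ℂ v (Φ f.complexify v)).re
      map_add' f g := by
        have : (f + g).complexify = f.complexify + g.complexify := by
          ext x
          exact Complex.ofReal_add (f x) (g x)
        rw [this, map_add, add_apply, inner_add_right, Complex.add_re]
      map_smul' a f := by
        have : (a • f).complexify = (a : ℂ) • f.complexify := by
          ext x
          exact Complex.ofReal_mul a (f x)
        rw [this, map_smul, smul_apply, inner_smul_right, Complex.re_ofReal_mul]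
        rfl }
  let Λ : CompactlySupportedContinuousMap (spectrum ℂ U) ℝ →ₚ[ℝ] ℝ :=
    PositiveLinearMap.mk₀ L fun f hf =>
      inner_cfcHom_nonneg v f.complexify f.toContinuousMap (fun _ => rfl) fun x => hf x
  let μ := RealRMK.rieszMeasure Λ
  refine ⟨μ, inferInstance, fun n => ?_⟩
  have key : ∀ (f : C(spectrum ℂ U, ℂ)) (g : C(spectrum ℂ U, ℝ)),
      (∀ x, f x = ((g x : ℝ) : ℂ)) → inner ℂ v (Φ f v) = ((∫ x, g x ∂μ : ℝ) : ℂ) := by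
    intro f g hfg
    let g' : CompactlySupportedContinuousMap (spectrum ℂ U) ℝ :=
      ⟨g, HasCompactSupport.of_compactSpace _⟩
    have h1 : ∫ x, g' x ∂μ = Λ g' := RealRMK.integral_rieszMeasure Λ g'
    have h2 : f = g'.complexify := by
      ext x
      exact hfg x
    apply Complex.ext
    · rw [Complex.ofReal_re]
      refine Eq.trans ?_ h1.symm
      rw [h2]
      rfl
    · rw [Complex.ofReal_im]
      exact inner_cfcHom_ofReal_im v f g hfg
  let p : C(spectrum ℂ U, ℂ) := (ContinuousMap.id ℂ).restrict (spectrum ℂ U) ^ n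
  have hp : Φ p = U ^ n := by
    rw [map_pow]
    congr 1
    exact cfcHom_id hN
  let pr : C(spectrum ℂ U, ℝ) := ⟨fun x => (p x).re, by fun_prop⟩
  let pi : C(spectrum ℂ U, ℝ) := ⟨fun x => (p x).im, by fun_prop⟩
  let fr : C(spectrum ℂ U, ℂ) := ⟨fun x => (pr x : ℂ), by fun_prop⟩
  let fi : C(spectrum ℂ U, ℂ) := ⟨fun x => (pi x : ℂ), by fun_prop⟩
  have hsum : p = fr + Complex.I • fi := by
    ext x
    exact (Complex.re_add_im (p x)).symm.trans (by rw [mul_comm]; rfl)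
  have hint : MeasureTheory.Integrable (fun x => p x) μ :=
    p.continuous.integrable_of_hasCompactSupport (HasCompactSupport.of_compactSpace _)
  rw [← hp, hsum, map_add, map_smul, add_apply, smul_apply,
    inner_add_right, inner_smul_right, key fr pr (fun _ => rfl), key fi pi (fun _ => rfl)]
  have h := integral_re_add_im hint
  refine Eq.trans ?_ h
  rw [mul_comm]
  rfl

end

/-! ### Wiener's lemma -/

section Averages

open MeasureTheory

/-- Dominated convergence: the averages of $f^n$ tend pointwise to the indicator of $\{f=1\}$. -/
theorem tendsto_integral_average_pow {X : Type*} [MeasurableSpace X] (μ : Measure X)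
    [IsFiniteMeasure μ] (f : X → ℂ) (hf : Measurable f) (hf1 : ∀ x, ‖f x‖ = 1) :
    Tendsto (fun N : ℕ => (N : ℂ)⁻¹ * ∑ n ∈ Finset.range N, ∫ x, f x ^ n ∂μ) atTop
      (𝓝 (μ.real {x | f x = 1})) := by
  have hint : ∀ n : ℕ, Integrable (fun x => f x ^ n) μ := fun n =>
    (integrable_const (1 : ℝ)).mono' (hf.pow_const n).aestronglyMeasurable
      (Eventually.of_forall fun x => by simp [hf1])
  have hset : MeasurableSet {x | f x = 1} := hf (measurableSet_singleton 1)
  have h : Tendsto (fun N : ℕ => ∫ x, (N : ℂ)⁻¹ * ∑ n ∈ Finset.range N, f x ^ n ∂μ) atTop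
      (𝓝 (∫ x, {x | f x = 1}.indicator (fun _ => (1 : ℂ)) x ∂μ)) := by
    refine tendsto_integral_of_dominated_convergence (fun _ => (1 : ℝ)) (fun N => ?_)
      (integrable_const _) (fun N => Eventually.of_forall fun x => ?_)
      (Eventually.of_forall fun x => ?_)
    · exact (Measurable.const_mul
        (Finset.measurable_sum _ fun n _ => hf.pow_const n) _).aestronglyMeasurable
    · exact norm_average_le zero_le_one (fun n => by simp [hf1]) N
    · simpa [Set.indicator_apply] using tendsto_average_pow (hf1 x)
  rw [integral_indicator hset] at h
  simp only [integral_const, Complex.real_smul, mul_one, measureReal_restrict_apply_univ] at h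
  refine h.congr fun N => ?_
  rw [integral_const_mul, integral_finsetSum _ fun n _ => hint n]

/-- **Wiener's lemma** for a finite measure without atoms on the unit circle. -/
theorem tendsto_average_norm_sq_integral_pow {X : Type*} [MeasurableSpace X] (μ : Measure X)
    [IsFiniteMeasure μ] (f : X → ℂ) (hf : Measurable f) (hf1 : ∀ x, ‖f x‖ = 1)
    (hatom : ∀ x, μ {y | f y = f x} = 0) :
    Tendsto (fun N : ℕ => (N : ℝ)⁻¹ * ∑ n ∈ Finset.range N, ‖∫ x, f x ^ n ∂μ‖ ^ 2) atTop
      (𝓝 0) := by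
  -- $\left|\int f^n\,d\mu\right|^2$ is the $n$-th moment of `g` under $\mu\otimes\mu$, so the
  -- averages tend to the mass of $\{f(x)=f(y)\}$, which is zero by Fubini.
  let g : X × X → ℂ := fun p => (starRingEnd ℂ) (f p.1) * f p.2
  have hg : Measurable g :=
    (Complex.continuous_conj.measurable.comp (hf.comp measurable_fst)).mul (hf.comp measurable_snd)
  have hg1 : ∀ p, ‖g p‖ = 1 := fun p => by simp [g, hf1]
  have h := tendsto_integral_average_pow (μ.prod μ) g hg hg1
  have hnull : (μ.prod μ) {p | g p = 1} = 0 := by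
    have hs : MeasurableSet {p | g p = 1} := hg (measurableSet_singleton 1)
    rw [Measure.measure_prod_null hs]
    refine Eventually.of_forall fun x => ?_
    refine measure_mono_null (fun y hy => ?_) (hatom x)
    have h1 : (starRingEnd ℂ) (f x) * f y = 1 := hy
    have h2 := conj_mul_eq_one_of_norm (hf1 x)
    exact mul_left_cancel₀ (left_ne_zero_of_mul_eq_one h2) (h1.trans h2.symm)
  rw [Measure.real, hnull] at h
  have h' := (Complex.continuous_re.tendsto _).comp h
  simp only [ENNReal.toReal_zero, Complex.ofReal_zero, Complex.zero_re] at h'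
  refine h'.congr fun N => ?_
  have hterm : ∀ n : ℕ, ∫ p, g p ^ n ∂(μ.prod μ) = ((‖∫ x, f x ^ n ∂μ‖ ^ 2 : ℝ) : ℂ) := by
    intro n
    have h1 : ∀ p, g p ^ n = (starRingEnd ℂ) (f p.1 ^ n) * f p.2 ^ n := fun p => by
      simp [g, mul_pow]
    simp_rw [h1]
    rw [integral_prod_mul (fun x => (starRingEnd ℂ) (f x ^ n)) (fun x => f x ^ n), integral_conj,
      mul_comm, Complex.mul_conj, Complex.normSq_eq_norm_sq]
  simp only [Function.comp_apply, hterm]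
  rw [← Complex.ofReal_sum, ← Complex.ofReal_natCast, ← Complex.ofReal_inv, ← Complex.ofReal_mul,
    Complex.ofReal_re]

theorem tendsto_average_of_sq {a : ℕ → ℝ} (ha : ∀ n, 0 ≤ a n)
    (h : Tendsto (fun N : ℕ => (N : ℝ)⁻¹ * ∑ n ∈ Finset.range N, a n ^ 2) atTop (𝓝 0)) :
    Tendsto (fun N : ℕ => (N : ℝ)⁻¹ * ∑ n ∈ Finset.range N, a n) atTop (𝓝 0) := by
  have h2 : Tendsto (fun N : ℕ => Real.sqrt ((N : ℝ)⁻¹ * ∑ n ∈ Finset.range N, a n ^ 2)) atTop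
      (𝓝 0) := by simpa using h.sqrt
  refine squeeze_zero (fun N => mul_nonneg (by positivity) (Finset.sum_nonneg fun n _ => ha n))
    (fun N => ?_) h2
  refine Real.le_sqrt_of_sq_le ?_
  have h3 : (∑ n ∈ Finset.range N, a n) ^ 2 ≤ N * ∑ n ∈ Finset.range N, a n ^ 2 := by
    simpa using sq_sum_le_card_mul_sum_sq (s := Finset.range N) (f := a)
  calc ((N : ℝ)⁻¹ * ∑ n ∈ Finset.range N, a n) ^ 2
      = (N : ℝ)⁻¹ ^ 2 * (∑ n ∈ Finset.range N, a n) ^ 2 := by ring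
    _ ≤ (N : ℝ)⁻¹ ^ 2 * (N * ∑ n ∈ Finset.range N, a n ^ 2) := by gcongr
    _ = (N : ℝ)⁻¹ * ∑ n ∈ Finset.range N, a n ^ 2 := by
        rcases eq_or_ne (N : ℝ) 0 with h0 | h0
        · simp [h0]
        · field_simp

end Averages

/-! ### The continuous subspace and the case of one pair -/

section

variable {H : Type*} [NormedAddCommGroup H] [InnerProductSpace ℂ H] [CompleteSpace H]
  {U : H →L[ℂ] H}

/-- By the mean ergodic theorem, the mass of the spectral measure at $w$ is $\langle
v,E_wv\rangle=0$, so Wiener's lemma applies; Cauchy–Schwarz then removes the square. -/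
theorem tendsto_average_norm_inner_pow_self (hU : U ∈ unitary (H →L[ℂ] H)) {v : H}
    (hv : ∀ z, eigenProj U z v = 0) :
    Tendsto (fun N : ℕ => (N : ℝ)⁻¹ * ∑ n ∈ Finset.range N, ‖inner ℂ v ((U ^ n) v)‖) atTop
      (𝓝 0) := by
  have hN : IsStarNormal U :=
    ⟨(Unitary.star_mul_self_of_mem hU).trans (Unitary.mul_star_self_of_mem hU).symm⟩
  obtain ⟨μ, hμ, hint⟩ := exists_measure_inner_pow_eq_integral (U := U) v
  have hone : ∀ z : spectrum ℂ U, ‖(z : ℂ)‖ = 1 := fun z => by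
    simpa using spectrum.subset_circle_of_unitary hU z.2
  refine tendsto_average_of_sq (fun n => norm_nonneg _) ?_
  simp_rw [hint]
  refine tendsto_average_norm_sq_integral_pow μ _ measurable_subtype_coe hone fun w => ?_
  have h1 := tendsto_integral_average_pow μ (fun z : spectrum ℂ U => (starRingEnd ℂ) (w : ℂ) * z)
    (measurable_subtype_coe.const_mul _) (fun z => by simp [hone])
  have h2 : Tendsto (fun N : ℕ => inner ℂ v ((N : ℂ)⁻¹ • ∑ n ∈ Finset.range N,
      (starRingEnd ℂ) (w : ℂ) ^ n • (U ^ n) v)) atTop (𝓝 (inner ℂ v (eigenProj U w v))) :=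
    tendsto_const_nhds.inner (tendsto_average_conj_pow_smul hU (hone w) v)
  rw [hv, inner_zero_right] at h2
  have h3 := tendsto_nhds_unique (h1.congr fun N => by
    rw [inner_smul_right, inner_sum]
    congr 1
    refine Finset.sum_congr rfl fun n _ => ?_
    rw [inner_smul_right, hint, ← MeasureTheory.integral_const_mul]
    simp_rw [mul_pow]) h2
  have h4 : μ {z | (starRingEnd ℂ) (w : ℂ) * (z : ℂ) = 1} = 0 := by
    rw [Complex.ofReal_eq_zero, MeasureTheory.measureReal_eq_zero_iff] at h3
    exact h3
  refine MeasureTheory.measure_mono_null (fun z hz => ?_) h4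
  have hz' : (z : ℂ) = w := hz
  change (starRingEnd ℂ) (w : ℂ) * (z : ℂ) = 1
  rw [hz', conj_mul_eq_one_of_norm (hone w)]

/-- The closed subspace of vectors orthogonal to all eigenvectors. -/
noncomputable def continuousSubspace (U : H →L[ℂ] H) : Submodule ℂ H :=
  (Submodule.span ℂ {v | ∃ z : ℂ, U v = z • v})ᗮ

theorem eigenProj_eq_zero_of_mem_continuousSubspace {v : H} (hv : v ∈ continuousSubspace U)
    (z : ℂ) : eigenProj U z v = 0 := by
  rw [← inner_self_eq_zero (𝕜 := ℂ), inner_eigenProj_left, eigenProj_eigenProj,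
    ← inner_eigenProj_left]
  exact (Submodule.mem_orthogonal _ _).1 hv _ (Submodule.subset_span ⟨z, apply_eigenProj z v⟩)

theorem apply_mem_continuousSubspace (hU : U ∈ unitary (H →L[ℂ] H)) {v : H}
    (hv : v ∈ continuousSubspace U) : U v ∈ continuousSubspace U := by
  rw [continuousSubspace, Submodule.mem_orthogonal]
  intro e he
  induction he using Submodule.span_induction with
  | zero => simp
  | add x y _ _ hx hy => rw [inner_add_left, hx, hy, add_zero]
  | smul a x _ hx => rw [inner_smul_left, hx, mul_zero]
  | mem e he =>
    have hev : inner ℂ e v = 0 := (Submodule.mem_orthogonal _ _).1 hv e (Submodule.subset_span he)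
    obtain ⟨z, hz⟩ := he
    by_cases he0 : e = 0
    · simp [he0]
    have hz1 := norm_eq_one_of_apply_eq_smul hU he0 hz
    have h := inner_apply_apply_of_mem_unitary hU e v
    rw [hz, inner_smul_left, hev] at h
    exact (mul_eq_zero.1 h).resolve_left
      (left_ne_zero_of_mul_eq_one (conj_mul_eq_one_of_norm hz1))

theorem pow_apply_mem_continuousSubspace (hU : U ∈ unitary (H →L[ℂ] H)) {v : H}
    (hv : v ∈ continuousSubspace U) (n : ℕ) : (U ^ n) v ∈ continuousSubspace U := by
  induction n with
  | zero => simpa using hv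
  | succ n ih => rw [pow_succ']; exact apply_mem_continuousSubspace hU ih

/-- Polarization reduces this to four diagonal matrix elements. -/
theorem tendsto_average_norm_inner_pow_of_mem (hU : U ∈ unitary (H →L[ℂ] H)) {u v : H}
    (hu : u ∈ continuousSubspace U) (hv : v ∈ continuousSubspace U) :
    Tendsto (fun N : ℕ => (N : ℝ)⁻¹ * ∑ n ∈ Finset.range N, ‖inner ℂ u ((U ^ n) v)‖) atTop
      (𝓝 0) := by
  have hself : ∀ w ∈ continuousSubspace U, Tendsto (fun N : ℕ => (N : ℝ)⁻¹ *
      ∑ n ∈ Finset.range N, ‖inner ℂ ((U ^ n) w) w‖) atTop (𝓝 0) := fun w hw =>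
    (tendsto_average_norm_inner_pow_self hU
      (eigenProj_eq_zero_of_mem_continuousSubspace hw)).congr fun N => by
        simp_rw [norm_inner_symm]
  have hIu := Submodule.smul_mem _ Complex.I hu
  have h := ((hself _ (add_mem hv hu)).add (hself _ (sub_mem hv hu))).add
    ((hself _ (add_mem hv hIu)).add (hself _ (sub_mem hv hIu)))
  simp only [add_zero] at h
  refine squeeze_zero (fun N => by positivity) (fun N => ?_) h
  simp only [← mul_add, ← Finset.sum_add_distrib]
  gcongr with n
  rw [← norm_inner_symm]
  have hp := inner_map_polarization' ((U ^ n : H →L[ℂ] H) : H →ₗ[ℂ] H) v u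
  simp only [ContinuousLinearMap.coe_coe] at hp
  rw [hp, norm_div]
  have h4 : ‖(4 : ℂ)‖ = 4 := by norm_num
  rw [h4]
  refine (div_le_self (norm_nonneg _) (by norm_num)).trans ?_
  refine (norm_add_le _ _).trans ?_
  refine (add_le_add_left (norm_sub_le _ _) _).trans ?_
  refine (add_le_add_left (add_le_add_left (norm_sub_le _ _) _) _).trans ?_
  simp only [norm_mul, Complex.norm_I, one_mul]
  linarith

theorem tendsto_average_norm_inner_pow (hU : U ∈ unitary (H →L[ℂ] H)) (u : H) {v : H}
    (hv : v ∈ continuousSubspace U) :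
    Tendsto (fun N : ℕ => (N : ℝ)⁻¹ * ∑ n ∈ Finset.range N, ‖inner ℂ u ((U ^ n) v)‖) atTop
      (𝓝 0) := by
  have : CompleteSpace (continuousSubspace U) :=
    inferInstanceAs (CompleteSpace ((Submodule.span ℂ {v | ∃ z : ℂ, U v = z • v})ᗮ : Submodule ℂ H))
  refine (tendsto_average_norm_inner_pow_of_mem hU
    ((continuousSubspace U).starProjection_apply_mem u) hv).congr fun N => ?_
  congr 1
  refine Finset.sum_congr rfl fun n _ => ?_
  rw [Submodule.inner_starProjection_left_eq_right, Submodule.starProjection_eq_self_iff.2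
    (pow_apply_mem_continuousSubspace hU hv n)]

theorem mem_sigmaPP_iff (hU : U ∈ unitary (H →L[ℂ] H)) {z : ℂ} :
    z ∈ sigmaPP U ↔ ∃ x : H, x ≠ 0 ∧ U x = z • x := by
  constructor
  · rintro ⟨_, h⟩
    obtain ⟨x, hx⟩ := h.exists_hasEigenvector
    exact ⟨x, hx.2, mem_eigenspace_clm.1 hx.1⟩
  · rintro ⟨x, hx, h⟩
    exact ⟨norm_eq_one_of_apply_eq_smul hU hx h,
      Module.End.hasEigenvalue_of_hasEigenvector ⟨mem_eigenspace_clm.2 h, hx⟩⟩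

theorem mem_sigmaPPA (hU : U ∈ unitary (H →L[ℂ] H)) {z : ℂ} {x y : H} (hx : x ≠ 0)
    (hxz : U x = z • x) (hy : y ≠ 0) (hyz : U y = (starRingEnd ℂ) z • y) : z ∈ sigmaPPA U :=
  ⟨(mem_sigmaPP_iff hU).2 ⟨x, hx, hxz⟩, (starRingEnd ℂ) z, (mem_sigmaPP_iff hU).2 ⟨y, hy, hyz⟩, by
    rw [mul_comm, conj_mul_eq_one_of_norm (norm_eq_one_of_apply_eq_smul hU hx hxz)]⟩

theorem norm_eigenProj_apply_le (z : ℂ) (x : H) : ‖eigenProj U z x‖ ≤ ‖x‖ :=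
  Submodule.norm_starProjection_apply_le _ x

/-- The second factor is bounded termwise by $\|u'\|\|v'\|$; Cauchy–Schwarz and Bessel bound the sum
of the first. -/
theorem norm_sum_inner_eigenProj_mul_le (hU : U ∈ unitary (H →L[ℂ] H)) (F : Finset (sigmaPPA U))
    (u v u' v' : H) :
    ‖∑ z ∈ F, inner ℂ u (eigenProj U z v) * inner ℂ u' (eigenProj U (starRingEnd ℂ z) v')‖ ≤
      ‖u‖ * ‖u'‖ * ‖v'‖ * ‖v‖ := by
  have hsq : ∀ x : H, ∑ z ∈ F, ‖eigenProj U z x‖ ^ 2 ≤ ‖x‖ ^ 2 := fun x => by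
    have h := sum_norm_sq_eigenProj hU (F.map (Function.Embedding.subtype _)) x
    rw [Finset.sum_map] at h
    refine h.le.trans ?_
    gcongr
    exact norm_sum_eigenProj_apply_le hU _ x
  have hCS : ∑ z ∈ F, ‖eigenProj U z u‖ * ‖eigenProj U z v‖ ≤ ‖u‖ * ‖v‖ := by
    refine (Real.sum_mul_le_sqrt_mul_sqrt _ _ _).trans ?_
    gcongr
    · exact Real.sqrt_le_iff.2 ⟨norm_nonneg _, hsq u⟩
    · exact Real.sqrt_le_iff.2 ⟨norm_nonneg _, hsq v⟩
  calc _ ≤ ∑ z ∈ F, ‖eigenProj U z u‖ * ‖eigenProj U z v‖ * (‖u'‖ * ‖v'‖) := by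
        refine norm_sum_le_of_le _ fun z _ => ?_
        rw [norm_mul, ← eigenProj_eigenProj (z : ℂ) v, ← inner_eigenProj_left]
        gcongr
        · exact (norm_inner_le_norm _ _).trans_eq (by rw [eigenProj_eigenProj])
        · refine (norm_inner_le_norm _ _).trans ?_
          gcongr
          exact norm_eigenProj_apply_le _ _
    _ ≤ ‖u‖ * ‖v‖ * (‖u'‖ * ‖v'‖) := by
        rw [← Finset.sum_mul]
        gcongr
    _ = _ := by ring

/-- The **entangled ergodic theorem** for a single pair, on matrix elements: the two averages have
a common limit. -/
theorem exists_tendsto_average_inner_mul_inner (hU : U ∈ unitary (H →L[ℂ] H)) (u v u' v' : H) :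
    ∃ c : ℂ,
      Tendsto (fun N : ℕ => (N : ℂ)⁻¹ * ∑ n ∈ Finset.range N,
        inner ℂ u ((U ^ n) v) * inner ℂ u' ((U ^ n) v')) atTop (𝓝 c) ∧
      Tendsto (fun F : Finset (sigmaPPA U) => ∑ z ∈ F,
        inner ℂ u (eigenProj U z v) * inner ℂ u' (eigenProj U (starRingEnd ℂ z) v')) atTop
        (𝓝 c) := by
  let T : ℕ ⊕ Finset (sigmaPPA U) → H →ₗ[ℂ] ℂ := Sum.elim
    (fun N => (N : ℂ)⁻¹ • ∑ n ∈ Finset.range N, (inner ℂ u' ((U ^ n) v')) •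
      (((innerSL ℂ u).comp (U ^ n) : H →L[ℂ] ℂ) : H →ₗ[ℂ] ℂ))
    (fun F => ∑ z ∈ F, (inner ℂ u' (eigenProj U (starRingEnd ℂ z) v')) •
      (((innerSL ℂ u).comp (eigenProj U z) : H →L[ℂ] ℂ) : H →ₗ[ℂ] ℂ))
  have hTl : ∀ N x, T (Sum.inl N) x = (N : ℂ)⁻¹ * ∑ n ∈ Finset.range N,
      inner ℂ u ((U ^ n) x) * inner ℂ u' ((U ^ n) v') := fun N x => by
    simp only [T, Sum.elim_inl, LinearMap.smul_apply, LinearMap.sum_apply,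
      ContinuousLinearMap.coe_coe, ContinuousLinearMap.comp_apply, innerSL_apply_apply,
      smul_eq_mul, mul_comm]
  have hTr : ∀ F x, T (Sum.inr F) x = ∑ z ∈ F,
      inner ℂ u (eigenProj U z x) * inner ℂ u' (eigenProj U (starRingEnd ℂ z) v') := fun F x => by
    simp only [T, Sum.elim_inr, LinearMap.smul_apply, LinearMap.sum_apply,
      ContinuousLinearMap.coe_coe, ContinuousLinearMap.comp_apply, innerSL_apply_apply,
      smul_eq_mul, mul_comm]
  -- Linearity in `v` and the uniform bound leave only eigenvectors and vectors orthogonal to all of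
  -- them.
  let R : Set H := {v | ∃ z : ℂ, U v = z • v} ∪ continuousSubspace U
  have htop : (Submodule.span ℂ R).topologicalClosure = ⊤ := by
    rw [Submodule.topologicalClosure_eq_top_iff, Submodule.span_union, Submodule.span_eq,
      ← Submodule.inf_orthogonal]
    exact Submodule.inf_orthogonal_eq_bot _
  suffices ∃ c, Tendsto (fun i => T i v) (map Sum.inl atTop ⊔ map Sum.inr atTop) (𝓝 c) by
    obtain ⟨c, hc⟩ := this
    rw [tendsto_sup, tendsto_map'_iff, tendsto_map'_iff] at hc
    exact ⟨c, hc.1.congr fun N => hTl N v, hc.2.congr fun F => hTr F v⟩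
  refine exists_tendsto_of_mem_closure_span T R (‖u‖ * ‖u'‖ * ‖v'‖) ?_ ?_ (by rw [htop]; trivial)
  · rintro (N | F) x -
    · rw [hTl]
      refine norm_average_le (by positivity) (fun n => ?_) N
      rw [norm_mul]
      calc _ ≤ (‖u‖ * ‖(U ^ n) x‖) * (‖u'‖ * ‖(U ^ n) v'‖) := by
            gcongr <;> exact norm_inner_le_norm _ _
        _ = _ := by
            rw [norm_pow_apply_of_mem_unitary hU, norm_pow_apply_of_mem_unitary hU]
            ring
    · rw [hTr]
      exact norm_sum_inner_eigenProj_mul_le hU F u x u' v'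
  · rintro x (⟨z, hz⟩ | hx)
    · by_cases hx0 : x = 0
      · exact ⟨0, by simpa only [hx0, map_zero] using tendsto_const_nhds⟩
      have hz1 := norm_eq_one_of_apply_eq_smul hU hx0 hz
      have hpow : ∀ n : ℕ, (U ^ n) x = z ^ n • x := by
        intro n
        induction n with
        | zero => simp
        | succ n ih =>
          rw [pow_succ', mul_apply_eq_comp, ih, map_smul, hz, smul_smul, pow_succ]
      refine ⟨inner ℂ u x * inner ℂ u' (eigenProj U (starRingEnd ℂ z) v'), ?_⟩
      rw [tendsto_sup, tendsto_map'_iff, tendsto_map'_iff]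
      constructor
      -- The eigenvalue $z^n$ from the first factor moves to $v'$, where averaging $z^nU^n$ gives
      -- $E_{\bar z}$.
      · have h := (tendsto_average_conj_pow_smul hU (z := starRingEnd ℂ z) (by simpa using hz1) v')
        have h' := (tendsto_const_nhds (x := u')).inner (𝕜 := ℂ) h
        refine (h'.const_mul (inner ℂ u x)).congr fun N => ?_
        simp only [Function.comp_apply, hTl, hpow, inner_smul_right, inner_sum, Complex.conj_conj,
          Finset.mul_sum]
        refine Finset.sum_congr rfl fun n _ => ?_
        ring
      · by_cases hzA : z ∈ sigmaPPA U
        · refine tendsto_const_nhds.congr' ?_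
          filter_upwards [eventually_ge_atTop {⟨z, hzA⟩}] with F hF
          rw [Function.comp_apply, hTr, Finset.sum_eq_single ⟨z, hzA⟩]
          · rw [eigenProj_apply_of_apply_eq hz]
          · intro w _ hw
            rw [eigenProj_apply_of_ne hU (fun h => hw (Subtype.ext h)) hz, inner_zero_right,
              zero_mul]
          · exact fun h => absurd (hF (Finset.mem_singleton_self _)) h
        -- Since $z$ is an eigenvalue, $z\notin\sigma^a_{pp}(U)$ means that $\bar z=z^{-1}$ is not
        -- one, so both limits vanish.
        · have h0 : eigenProj U (starRingEnd ℂ z) v' = 0 := by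
            by_contra hne
            exact hzA (mem_sigmaPPA hU hx0 hz hne (apply_eigenProj _ _))
          rw [h0, inner_zero_right, mul_zero]
          refine tendsto_const_nhds.congr fun F => ?_
          rw [Function.comp_apply, hTr, Finset.sum_eq_zero]
          intro w _
          rw [eigenProj_apply_of_ne hU (ne_of_mem_of_not_mem w.2 hzA) hz, inner_zero_right, zero_mul]
    · refine ⟨0, ?_⟩
      rw [tendsto_sup, tendsto_map'_iff, tendsto_map'_iff]
      constructor
      · have h := (tendsto_average_norm_inner_pow hU u hx).mul_const (‖u'‖ * ‖v'‖)
        rw [zero_mul] at h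
        refine squeeze_zero_norm (fun N => ?_) h
        rw [Function.comp_apply, hTl, norm_mul, norm_inv, Complex.norm_natCast, mul_assoc,
          Finset.sum_mul]
        gcongr
        refine norm_sum_le_of_le _ fun n _ => ?_
        rw [norm_mul]
        gcongr
        exact (norm_inner_le_norm _ _).trans_eq (by rw [norm_pow_apply_of_mem_unitary hU])
      · refine tendsto_const_nhds.congr fun F => ?_
        rw [Function.comp_apply, hTr, Finset.sum_eq_zero]
        intro w _
        rw [eigenProj_eq_zero_of_mem_continuousSubspace hx, inner_zero_right, zero_mul]

end

/-! ### Algebra and norm of alternating products -/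

section AlternatingProd

theorem alternatingProd_one {M : Type*} [Monoid M] (V : Fin 1 → M) (A : Fin 0 → M) :
    alternatingProd (m := 1) V A = V 0 := by
  simp [alternatingProd]

theorem alternatingProd_succ {M : Type*} [Monoid M] {p : ℕ} (V : Fin (p + 2) → M)
    (A : Fin (p + 1) → M) :
    alternatingProd (m := p + 2) V A =
      V 0 * A 0 * alternatingProd (m := p + 1) (fun i => V i.succ) (fun i : Fin p => A i.succ) := by
  unfold alternatingProd
  rw [List.ofFn_succ, List.prod_cons]
  congr 3
  funext i
  congr 1
  by_cases h : (i : ℕ) < p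
  · rw [dif_pos (by simpa using h), dif_pos (by simpa using h)]
    rfl
  · rw [dif_neg (by simpa using h), dif_neg (by simpa using h)]

theorem alternatingProd_eq_prod_mul {M : Type*} [Monoid M] {p : ℕ} (V : Fin (p + 1) → M)
    (A : Fin p → M) :
    alternatingProd (m := p + 1) V A =
      (List.ofFn fun i : Fin p => V i.castSucc * A i).prod * V (Fin.last p) := by
  unfold alternatingProd
  rw [List.ofFn_succ_last, List.prod_append, List.prod_singleton, dif_neg (by simp), mul_one]
  congr 3
  funext i
  rw [dif_pos (by simp)]
  rfl

theorem alternatingProd_eq_zero {M : Type*} [MonoidWithZero M] {m : ℕ} {V : Fin m → M}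
    (A : Fin (m - 1) → M) {i : Fin m} (h : V i = 0) : alternatingProd V A = 0 :=
  List.prod_eq_zero (List.mem_ofFn.2 ⟨i, by simp [h]⟩)

theorem exists_multilinearMap_eq_alternatingProd {B : Type*} [Ring B] [Algebra ℂ B] {m : ℕ}
    (V : Fin m → B) :
    ∃ L : MultilinearMap ℂ (fun _ : Fin (m - 1) => B) B, ∀ A, L A = alternatingProd V A := by
  cases m with
  | zero =>
    exact ⟨MultilinearMap.constOfIsEmpty ℂ (fun _ : Fin 0 => B) 1, fun A => by
      simp [alternatingProd]⟩
  | succ p =>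
    refine ⟨(LinearMap.mulRight ℂ (V (Fin.last p))).compMultilinearMap
      ((MultilinearMap.mkPiAlgebraFin ℂ p B).compLinearMap
        fun i => LinearMap.mulLeft ℂ (V i.castSucc)), fun A => ?_⟩
    refine Eq.trans ?_ (alternatingProd_eq_prod_mul V A).symm
    simp

variable {H : Type*} [NormedAddCommGroup H] [InnerProductSpace ℂ H]

theorem norm_alternatingProd_le {m : ℕ} (V A) (hV : ∀ i, ‖V i‖ ≤ 1) :
    ‖alternatingProd (M := H →L[ℂ] H) (m := m) V A‖ ≤ ∏ i, ‖A i‖ := by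
  rcases m with _ | p
  -- Only an inequality, since the identity has norm $0$ on the zero space.
  · have h : ‖(1 : H →L[ℂ] H)‖ ≤ 1 := ContinuousLinearMap.norm_id_le
    simpa [alternatingProd] using h
  induction p with
  | zero =>
    rw [alternatingProd_one]
    simpa using hV 0
  | succ p ih =>
    rw [alternatingProd_succ]
    refine (norm_mul_le _ _).trans ?_
    refine le_of_le_of_eq ?_ (Fin.prod_univ_succ (fun i : Fin (p + 1) => ‖A i‖)).symm
    gcongr
    · refine (norm_mul_le _ _).trans ?_
      exact mul_le_of_le_one_left (norm_nonneg _) (hV 0)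
    · exact ih _ _ fun i => hV i.succ

/-- Each rank-one factor $\langle b,\cdot\rangle a$ cuts the chain: $b$ closes the matrix element on
its left side of the product's remainder and $a$ feeds the preceding one. -/
theorem exists_inner_alternatingProd_eq_prod {m : ℕ} (hm : 1 ≤ m) (A : Fin (m - 1) → H →L[ℂ] H)
    (hA : ∀ i, A i ∈ rankOneOperators H) (x y : H) :
    ∃ u v : Fin m → H, ∀ V : Fin m → H →L[ℂ] H,
      inner ℂ x (alternatingProd V A y) = ∏ i, inner ℂ (u i) (V i (v i)) := by
  obtain ⟨p, rfl⟩ : ∃ p, m = p + 1 := ⟨m - 1, by lia⟩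
  clear hm
  induction p generalizing x with
  | zero =>
    refine ⟨fun _ => x, fun _ => y, fun V => ?_⟩
    rw [alternatingProd_one]
    simp
  | succ p ih =>
    obtain ⟨a, b, hab⟩ := hA (0 : Fin (p + 1))
    obtain ⟨u, v, h⟩ := ih b (fun i : Fin p => A (Fin.succ i)) (fun i => hA (Fin.succ i))
    refine ⟨Fin.cons x u, Fin.cons a v, fun V => ?_⟩
    rw [alternatingProd_succ, Fin.prod_univ_succ, ← hab]
    simp only [mul_apply_eq_comp, InnerProductSpace.rankOne_apply, map_smul, inner_smul_right,
      Fin.cons_zero, Fin.cons_succ]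
    rw [mul_comm]
    congr 1
    exact h fun i => V i.succ

end AlternatingProd

/-! ### Entangled sums: factorization over pairs and uniform bounds -/

section EntangledSum

variable {B X : Type*} {k : ℕ}

/-- The entangled sum `∑ V_{1, n_{α(1)}} A₁ V_{2, n_{α(2)}} ⋯ A_{2k-1} V_{2k, n_{α(2k)}}` over all
`n₁, …, n_k ∈ s`. -/
def entangledSum [Semiring B] (α : Fin (2 * k) → Fin k) (V : Fin (2 * k) → X → B) (s : Finset X)
    (A : Fin (2 * k - 1) → B) : B :=
  ∑ n ∈ Fintype.piFinset (fun _ : Fin k => s), alternatingProd (fun i => V i (n (α i))) A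

theorem exists_multilinearMap_eq_entangledSum [Ring B] [Algebra ℂ B] (α : Fin (2 * k) → Fin k)
    (V : Fin (2 * k) → X → B) (s : Finset X) :
    ∃ L : MultilinearMap ℂ (fun _ : Fin (2 * k - 1) => B) B, ∀ A, L A = entangledSum α V s A := by
  choose L hL using fun n : Fin k → X =>
    exists_multilinearMap_eq_alternatingProd (fun i => V i (n (α i)))
  refine ⟨∑ n ∈ Fintype.piFinset (fun _ : Fin k => s), L n, fun A => ?_⟩
  rw [_root_.sum_apply]
  exact Finset.sum_congr rfl fun n _ => hL n A

variable {H : Type*} [NormedAddCommGroup H] [InnerProductSpace ℂ H]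

/-- A crude count of terms: for means the factor cancels against $N^{-k}$, while for partial sums it
serves only with the finite set fixed. -/
theorem norm_inner_entangledSum_le (α : Fin (2 * k) → Fin k) (V : Fin (2 * k) → X → H →L[ℂ] H)
    (hV : ∀ i n, ‖V i n‖ ≤ 1) (s : Finset X) (A : Fin (2 * k - 1) → H →L[ℂ] H) (x y : H) :
    ‖inner ℂ x (entangledSum α V s A y)‖ ≤ (s.card : ℝ) ^ k * (‖x‖ * ‖y‖ * ∏ i, ‖A i‖) := by
  have h : ‖entangledSum α V s A‖ ≤ (s.card : ℝ) ^ k * ∏ i, ‖A i‖ := by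
    refine (norm_sum_le_of_le _ fun n _ => norm_alternatingProd_le _ A fun i => hV i _).trans ?_
    simp
  calc ‖inner ℂ x (entangledSum α V s A y)‖ ≤ ‖x‖ * ‖entangledSum α V s A y‖ :=
        norm_inner_le_norm _ _
    _ ≤ ‖x‖ * (((s.card : ℝ) ^ k * ∏ i, ‖A i‖) * ‖y‖) := by
        gcongr
        exact ContinuousLinearMap.le_of_opNorm_le _ h y
    _ = _ := by ring

theorem entangledMean_eq (U : H →L[ℂ] H) (α : Fin (2 * k) → Fin k)
    (A : Fin (2 * k - 1) → H →L[ℂ] H) (N : ℕ) :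
    entangledMean U α A N =
      ((N : ℂ) ^ k)⁻¹ • entangledSum α (fun _ n => U ^ n) (Finset.range N) A := rfl

theorem norm_average_inner_entangledSum_le (α : Fin (2 * k) → Fin k)
    (V : Fin (2 * k) → ℕ → H →L[ℂ] H) (hV : ∀ i n, ‖V i n‖ ≤ 1) (N : ℕ)
    (A : Fin (2 * k - 1) → H →L[ℂ] H) (x y : H) :
    ‖((N : ℂ) ^ k)⁻¹ * inner ℂ x (entangledSum α V (Finset.range N) A y)‖ ≤
      ‖x‖ * ‖y‖ * ∏ i, ‖A i‖ := by
  have h := norm_inner_entangledSum_le α V hV (Finset.range N) A x y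
  rw [Finset.card_range] at h
  rw [norm_mul, norm_inv, norm_pow, Complex.norm_natCast]
  refine (mul_le_mul_of_nonneg_left h (by positivity)).trans ?_
  rw [← mul_assoc]
  refine mul_le_of_le_one_left (by positivity) ?_
  exact inv_mul_le_one

theorem exists_multilinearMap_eq_inner_entangledSum (α : Fin (2 * k) → Fin k)
    (V : Fin (2 * k) → X → H →L[ℂ] H) (s : Finset X) (a : ℂ) (x y : H) :
    ∃ L : MultilinearMap ℂ (fun _ : Fin (2 * k - 1) => H →L[ℂ] H) ℂ,
      ∀ A, L A = a * inner ℂ x (entangledSum α V s A y) := by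
  obtain ⟨L, hL⟩ := exists_multilinearMap_eq_entangledSum α V s
  refine ⟨(a • ((innerSL ℂ x).comp (ContinuousLinearMap.apply ℂ H y) :
    (H →L[ℂ] H) →ₗ[ℂ] ℂ)).compMultilinearMap L, fun A => ?_⟩
  rw [← hL A]
  rfl

theorem IsPairPartition.exists_pairs {α : Fin (2 * k) → Fin k} (hα : IsPairPartition α) :
    ∃ a b : Fin k → Fin (2 * k), ∀ j, a j < b j ∧
      (Finset.univ.filter fun i => α i = j) = {a j, b j} := by
  have : ∀ j, ∃ p : Fin (2 * k) × Fin (2 * k), p.1 < p.2 ∧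
      (Finset.univ.filter fun i => α i = j) = {p.1, p.2} := by
    intro j
    obtain ⟨a, b, hab, h⟩ := Finset.card_eq_two.1 (hα j)
    rcases lt_or_gt_of_ne hab with hlt | hlt
    · exact ⟨(a, b), hlt, h⟩
    · exact ⟨(b, a), hlt, h.trans (Finset.pair_comm a b)⟩
  choose p hp using this
  exact ⟨fun j => (p j).1, fun j => (p j).2, hp⟩

/-- The factors at the two positions of pair $j$ depend on $n_j$ alone, so the sum over
$(n_1,\dots,n_k)$ is a product of $k$ sums. -/
theorem inner_entangledSum_eq_prod {α : Fin (2 * k) → Fin k} {a b : Fin k → Fin (2 * k)}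
    (hab : ∀ j, a j < b j ∧ (Finset.univ.filter fun i => α i = j) = {a j, b j})
    (V : Fin (2 * k) → X → H →L[ℂ] H) (s : Finset X) (A : Fin (2 * k - 1) → H →L[ℂ] H)
    {x y : H} {u v : Fin (2 * k) → H}
    (h : ∀ W : Fin (2 * k) → H →L[ℂ] H,
      inner ℂ x (alternatingProd W A y) = ∏ i, inner ℂ (u i) (W i (v i))) :
    inner ℂ x (entangledSum α V s A y) = ∏ j, ∑ n ∈ s,
      inner ℂ (u (a j)) (V (a j) n (v (a j))) * inner ℂ (u (b j)) (V (b j) n (v (b j))) := by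
  rw [Finset.prod_univ_sum, entangledSum, _root_.sum_apply, inner_sum]
  refine Finset.sum_congr rfl fun n _ => ?_
  rw [h, ← Finset.prod_fiberwise Finset.univ α]
  refine Finset.prod_congr rfl fun j _ => ?_
  have hmem : ∀ i ∈ ({a j, b j} : Finset (Fin (2 * k))), α i = j := fun i hi => by
    rw [← (hab j).2] at hi
    exact (Finset.mem_filter.1 hi).2
  rw [(hab j).2, Finset.prod_pair (hab j).1.ne, hmem (a j) (by simp), hmem (b j) (by simp)]

/-- The map `z ↦ z^#` at the position `i`: the identity at the first element of a pair, the complex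
conjugation at the second one. -/
noncomputable def sharpMap (α : Fin (2 * k) → Fin k) (i : Fin (2 * k)) (z : ℂ) : ℂ :=
  if ∃ i' < i, α i' = α i then starRingEnd ℂ z else z

theorem sharpMap_injective (α : Fin (2 * k) → Fin k) (i : Fin (2 * k)) :
    Function.Injective (sharpMap α i) := by
  intro z w h
  unfold sharpMap at h
  split_ifs at h
  · exact (starRingEnd ℂ).injective h
  · exact h

theorem sharpMap_fst {α : Fin (2 * k) → Fin k} {a b : Fin k → Fin (2 * k)}
    (hab : ∀ j, a j < b j ∧ (Finset.univ.filter fun i => α i = j) = {a j, b j}) (j : Fin k)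
    (z : ℂ) : sharpMap α (a j) z = z := by
  refine if_neg ?_
  rintro ⟨i, hi, h⟩
  have haj : a j ∈ Finset.univ.filter fun i => α i = j := by simp [(hab j).2]
  have hij : i ∈ Finset.univ.filter fun i => α i = j :=
    Finset.mem_filter.2 ⟨Finset.mem_univ _, h.trans (Finset.mem_filter.1 haj).2⟩
  rw [(hab j).2, Finset.mem_insert, Finset.mem_singleton] at hij
  rcases hij with rfl | rfl
  · exact lt_irrefl _ hi
  · exact lt_asymm hi (hab j).1

theorem sharpMap_snd {α : Fin (2 * k) → Fin k} {a b : Fin k → Fin (2 * k)}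
    (hab : ∀ j, a j < b j ∧ (Finset.univ.filter fun i => α i = j) = {a j, b j}) (j : Fin k)
    (z : ℂ) : sharpMap α (b j) z = starRingEnd ℂ z := by
  have haj : a j ∈ Finset.univ.filter fun i => α i = j := by simp [(hab j).2]
  have hbj : b j ∈ Finset.univ.filter fun i => α i = j := by simp [(hab j).2]
  exact if_pos ⟨a j, (hab j).1, (Finset.mem_filter.1 haj).2.trans (Finset.mem_filter.1 hbj).2.symm⟩

variable [CompleteSpace H]

theorem entangledPartialSum_eq (U : H →L[ℂ] H) (α : Fin (2 * k) → Fin k)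
    (A : Fin (2 * k - 1) → H →L[ℂ] H) (F : Finset (sigmaPPA U)) :
    entangledPartialSum U α A F =
      entangledSum α (fun i (z : sigmaPPA U) => eigenProj U (sharpMap α i z)) F A := rfl

/-- The operators `P i` pass to the vectors as adjoints. They are the identity in the main theorem
and finite sums of eigenprojections in the uniform bound. -/
theorem exists_tendsto_entangledSum_of_rankOne {U : H →L[ℂ] H} (hU : U ∈ unitary (H →L[ℂ] H))
    (hk : 1 ≤ k) {α : Fin (2 * k) → Fin k} (hα : IsPairPartition α)
    (P : Fin (2 * k) → H →L[ℂ] H) (A : Fin (2 * k - 1) → H →L[ℂ] H)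
    (hA : ∀ i, A i ∈ rankOneOperators H) (x y : H) :
    ∃ c : ℂ,
      Tendsto (fun N : ℕ => ((N : ℂ) ^ k)⁻¹ *
        inner ℂ x (entangledSum α (fun i n => P i * U ^ n) (Finset.range N) A y)) atTop (𝓝 c) ∧
      Tendsto (fun F : Finset (sigmaPPA U) => inner ℂ x
        (entangledSum α (fun i (z : sigmaPPA U) => P i * eigenProj U (sharpMap α i z)) F A y))
        atTop (𝓝 c) := by
  obtain ⟨u, v, huv⟩ := exists_inner_alternatingProd_eq_prod (by lia) A hA x y
  obtain ⟨a, b, hab⟩ := hα.exists_pairs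
  choose c hc using fun j => exists_tendsto_average_inner_mul_inner hU
    ((P (a j)).adjoint (u (a j))) (v (a j)) ((P (b j)).adjoint (u (b j))) (v (b j))
  refine ⟨∏ j, c j, (tendsto_finsetProd _ fun j _ => (hc j).1).congr fun N => ?_,
    (tendsto_finsetProd _ fun j _ => (hc j).2).congr fun F => ?_⟩
  · rw [inner_entangledSum_eq_prod hab _ _ _ huv, Finset.prod_mul_distrib]
    congr 1
    · simp
    · simp only [ContinuousLinearMap.adjoint_inner_left, mul_apply_eq_comp]
  · rw [inner_entangledSum_eq_prod hab _ _ _ huv]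
    simp only [ContinuousLinearMap.adjoint_inner_left, mul_apply_eq_comp, sharpMap_fst hab,
      sharpMap_snd hab]

theorem norm_sum_eigenProj_le {U : H →L[ℂ] H} (hU : U ∈ unitary (H →L[ℂ] H)) {σ : X → ℂ}
    (hσ : Function.Injective σ) (F : Finset X) : ‖∑ z ∈ F, eigenProj U (σ z)‖ ≤ 1 := by
  refine ContinuousLinearMap.opNorm_le_bound _ zero_le_one fun x => ?_
  have h := norm_sum_eigenProj_apply_le hU (F.map ⟨σ, hσ⟩) x
  rw [Finset.sum_map] at h
  simpa [_root_.sum_apply] using h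

theorem sum_eigenProj_mul_eigenProj_of_mem {U : H →L[ℂ] H} (hU : U ∈ unitary (H →L[ℂ] H))
    {σ : X → ℂ} (hσ : Function.Injective σ) {F : Finset X} {z : X} (hz : z ∈ F) :
    (∑ w ∈ F, eigenProj U (σ w)) * eigenProj U (σ z) = eigenProj U (σ z) := by
  ext x
  rw [mul_apply_eq_comp, _root_.sum_apply, Finset.sum_eq_single z]
  · exact eigenProj_eigenProj _ _
  · exact fun w _ hw => eigenProj_apply_of_ne hU (hσ.ne hw) (apply_eigenProj _ _)
  · exact fun h => absurd hz h

theorem sum_eigenProj_mul_eigenProj_of_notMem {U : H →L[ℂ] H} (hU : U ∈ unitary (H →L[ℂ] H))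
    {σ : X → ℂ} (hσ : Function.Injective σ) {F : Finset X} {z : X} (hz : z ∉ F) :
    (∑ w ∈ F, eigenProj U (σ w)) * eigenProj U (σ z) = 0 := by
  ext x
  rw [mul_apply_eq_comp, _root_.sum_apply, Finset.sum_eq_zero]
  · rfl
  · exact fun w hw => eigenProj_apply_of_ne hU (hσ.ne (ne_of_mem_of_not_mem hw hz))
      (apply_eigenProj _ _)

theorem norm_eigenProj_le (U : H →L[ℂ] H) (z : ℂ) : ‖eigenProj U z‖ ≤ 1 :=
  Submodule.starProjection_norm_le _

/-- The truncation to $F$ fixes the terms with all indices in $F$ and kills the others, so the net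
over $F'$ is eventually constant. -/
theorem entangledSum_sum_eigenProj_mul {U : H →L[ℂ] H} (hU : U ∈ unitary (H →L[ℂ] H))
    {α : Fin (2 * k) → Fin k} (hα : IsPairPartition α) (A : Fin (2 * k - 1) → H →L[ℂ] H)
    {F F' : Finset (sigmaPPA U)} (hF : F ⊆ F') :
    entangledSum α (fun i (z : sigmaPPA U) =>
      (∑ w ∈ F, eigenProj U (sharpMap α i w)) * eigenProj U (sharpMap α i z)) F' A =
      entangledPartialSum U α A F := by
  obtain ⟨a, b, hab⟩ := hα.exists_pairs
  have hinj : ∀ i, Function.Injective fun z : sigmaPPA U => sharpMap α i z := fun i =>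
    (sharpMap_injective α i).comp Subtype.val_injective
  rw [entangledPartialSum_eq, entangledSum, entangledSum]
  rw [← Finset.sum_subset (Fintype.piFinset_subset _ _ fun _ => hF)]
  · refine Finset.sum_congr rfl fun n hn => ?_
    congr 1
    funext i
    exact sum_eigenProj_mul_eigenProj_of_mem hU (hinj i) (Fintype.mem_piFinset.1 hn (α i))
  · intro n _ hn
    rw [Fintype.mem_piFinset, not_forall] at hn
    obtain ⟨j, hj⟩ := hn
    have haj : a j ∈ Finset.univ.filter fun i => α i = j := by simp [(hab j).2]
    rw [← (Finset.mem_filter.1 haj).2] at hj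
    exact alternatingProd_eq_zero A (i := a j)
      (sum_eigenProj_mul_eigenProj_of_notMem hU (hinj (a j)) hj)

theorem norm_pow_le_one_of_mem_unitary {U : H →L[ℂ] H} (hU : U ∈ unitary (H →L[ℂ] H)) (n : ℕ) :
    ‖U ^ n‖ ≤ 1 :=
  ContinuousLinearMap.opNorm_le_bound _ zero_le_one fun x => by
    rw [norm_pow_apply_of_mem_unitary hU, one_mul]

/-- The partial sums are bounded uniformly in the finite set of eigenvalues: they are limits of
entangled means of contractions. -/
theorem norm_inner_entangledPartialSum_le {U : H →L[ℂ] H} (hU : U ∈ unitary (H →L[ℂ] H))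
    (hk : 1 ≤ k) {α : Fin (2 * k) → Fin k} (hα : IsPairPartition α)
    {A : Fin (2 * k - 1) → H →L[ℂ] H}
    (hA : ∀ i, A i ∈ (Submodule.span ℂ (rankOneOperators H)).topologicalClosure)
    (F : Finset (sigmaPPA U)) (x y : H) :
    ‖inner ℂ x (entangledPartialSum U α A F y)‖ ≤ ‖x‖ * ‖y‖ * ∏ i, ‖A i‖ := by
  let P : Fin (2 * k) → H →L[ℂ] H := fun i => ∑ w ∈ F, eigenProj U (sharpMap α i w)
  have hPU : ∀ i n, ‖P i * U ^ n‖ ≤ 1 := fun i n =>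
    (norm_mul_le _ _).trans (mul_le_one₀ (norm_sum_eigenProj_le hU
      ((sharpMap_injective α i).comp Subtype.val_injective) F) (norm_nonneg _)
      (norm_pow_le_one_of_mem_unitary hU n))
  choose L hL using fun N : ℕ => exists_multilinearMap_eq_inner_entangledSum α
    (fun i n => P i * U ^ n) (Finset.range N) ((N : ℂ) ^ k)⁻¹ x y
  obtain ⟨L', hL'⟩ := exists_multilinearMap_eq_inner_entangledSum α
    (fun i (z : sigmaPPA U) => eigenProj U (sharpMap α i z)) F 1 x y
  simp only [one_mul, ← entangledPartialSum_eq] at hL'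
  -- The target `L'` joins the means as one extra index with the filter `pure`: a common limit must
  -- then equal `L' A`.
  suffices ∃ c, Tendsto (fun i => Sum.elim L (fun _ : Unit => L') i A)
      (map Sum.inl atTop ⊔ pure (Sum.inr ())) (𝓝 c) by
    obtain ⟨c, hc⟩ := this
    rw [tendsto_sup, tendsto_map'_iff, tendsto_pure_left] at hc
    have hcL : c = L' A := by
      by_contra hne
      exact hc.2 _ (isOpen_compl_singleton.mem_nhds hne) rfl
    rw [← hL', ← hcL]
    refine le_of_tendsto hc.1.norm (Eventually.of_forall fun N => ?_)
    change ‖L N A‖ ≤ _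
    rw [hL]
    exact norm_average_inner_entangledSum_le α _ hPU N A x y
  -- The constant may depend on $F$, being used only for existence of the limit; the sharp bound
  -- comes from the means.
  refine MultilinearMap.exists_tendsto_of_mem_closure_span _ (rankOneOperators H)
    ((1 + (F.card : ℝ) ^ k) * (‖x‖ * ‖y‖)) ?_ ?_ hA
  · intro i B _
    have h0 : 0 ≤ ‖x‖ * ‖y‖ * ∏ i, ‖B i‖ := by positivity
    have h1 : 0 ≤ (F.card : ℝ) ^ k * (‖x‖ * ‖y‖ * ∏ i, ‖B i‖) := by positivity
    rw [mul_assoc, add_mul, one_mul]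
    rcases i with N | -
    · have h := norm_average_inner_entangledSum_le α _ hPU N B x y
      rw [← hL] at h
      exact h.trans (le_add_of_nonneg_right h1)
    · have h := norm_inner_entangledSum_le α
        (fun i (z : sigmaPPA U) => eigenProj U (sharpMap α i z))
        (fun i z => norm_eigenProj_le U _) F B x y
      rw [← entangledPartialSum_eq, ← hL'] at h
      exact h.trans (le_add_of_nonneg_left h0)
  · intro B hB
    obtain ⟨c, hc1, hc2⟩ := exists_tendsto_entangledSum_of_rankOne hU hk hα P B hB x y
    have hc : c = L' B := by
      refine tendsto_nhds_unique hc2 (tendsto_const_nhds.congr' ?_)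
      filter_upwards [eventually_ge_atTop F] with F' hF'
      rw [entangledSum_sum_eigenProj_mul hU hα B hF', hL']
    refine ⟨c, ?_⟩
    rw [tendsto_sup, tendsto_map'_iff]
    refine ⟨hc1.congr fun N => (hL N B).symm, ?_⟩
    rw [hc]
    exact tendsto_pure_nhds (fun i => Sum.elim L (fun _ : Unit => L') i B) (Sum.inr ())

end EntangledSum

/-! ### The entangled ergodic theorem for compact operators -/

theorem theorem2p5 {H : Type*} [NormedAddCommGroup H] [InnerProductSpace ℂ H] [CompleteSpace H]
    (U : H →L[ℂ] H) (hU : U ∈ unitary (H →L[ℂ] H))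
    (k : ℕ) (hk : 1 ≤ k) (α : Fin (2 * k) → Fin k) (hα : IsPairPartition α)
    (A : Fin (2 * k - 1) → H →L[ℂ] H) (hA : ∀ i, IsCompactOperator (A i)) :
    ∃ S : H →L[ℂ] H,
      Tendsto (fun F : Finset (sigmaPPA U) =>
          ContinuousLinearMapWOT.ofCLM (entangledPartialSum U α A F))
        atTop (𝓝 (ContinuousLinearMapWOT.ofCLM S)) ∧
      Tendsto (fun N : ℕ =>
          ContinuousLinearMapWOT.ofCLM (entangledMean U α A N))
        atTop (𝓝 (ContinuousLinearMapWOT.ofCLM S)) := by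
  let T : (Fin (2 * k - 1) → H →L[ℂ] H) → Finset (sigmaPPA U) ⊕ ℕ → H →L[ℂ] H := fun A =>
    Sum.elim (entangledPartialSum U α A) (entangledMean U α A)
  have hW : ∀ i, A i ∈ (Submodule.span ℂ (rankOneOperators H)).topologicalClosure := fun i =>
    (hA i).mem_closure_span_rankOneOperators
  have hbound : ∀ (B : Fin (2 * k - 1) → H →L[ℂ] H),
      (∀ i, B i ∈ (Submodule.span ℂ (rankOneOperators H)).topologicalClosure) →
      ∀ i x y, ‖inner ℂ x (T B i y)‖ ≤ ‖x‖ * ‖y‖ * ∏ i, ‖B i‖ := by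
    rintro B hB (F | N) x y
    · exact norm_inner_entangledPartialSum_le hU hk hα hB F x y
    · change ‖inner ℂ x (entangledMean U α B N y)‖ ≤ _
      rw [entangledMean_eq, smul_apply, inner_smul_right]
      exact norm_average_inner_entangledSum_le α _
        (fun _ => norm_pow_le_one_of_mem_unitary hU) N B x y
  suffices ∃ S : H →L[ℂ] H, Tendsto (fun i => ContinuousLinearMapWOT.ofCLM (T A i))
      (map Sum.inl atTop ⊔ map Sum.inr atTop) (𝓝 (ContinuousLinearMapWOT.ofCLM S)) by
    obtain ⟨S, hS⟩ := this
    rw [tendsto_sup, tendsto_map'_iff, tendsto_map'_iff] at hS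
    exact ⟨S, hS⟩
  refine exists_tendsto_wot (T A) (∏ i, ‖A i‖)
    (fun i x y => (hbound A hW i x y).trans_eq (by ring)) fun x y => ?_
  have hmulti : ∀ i, ∃ L : MultilinearMap ℂ (fun _ : Fin (2 * k - 1) => H →L[ℂ] H) ℂ,
      ∀ B, L B = inner ℂ x (T B i y) := by
    rintro (F | N)
    · obtain ⟨L, hL⟩ := exists_multilinearMap_eq_inner_entangledSum α
        (fun i (z : sigmaPPA U) => eigenProj U (sharpMap α i z)) F 1 x y
      exact ⟨L, fun B => (hL B).trans (one_mul _)⟩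
    · obtain ⟨L, hL⟩ := exists_multilinearMap_eq_inner_entangledSum α
        (fun _ n => U ^ n) (Finset.range N) ((N : ℂ) ^ k)⁻¹ x y
      exact ⟨L, fun B => (hL B).trans (inner_smul_right _ _ _).symm⟩
  choose L hL using hmulti
  simp only [← hL]
  refine MultilinearMap.exists_tendsto_of_mem_closure_span L (rankOneOperators H) (‖x‖ * ‖y‖)
    (fun i B hB => (congrArg norm (hL i B)).trans_le (hbound B hB i x y)) (fun B hB => ?_) hW
  -- On rank-one operators both families have the same limit, with trivial truncation `P i = 1`.
  obtain ⟨c, hc1, hc2⟩ := exists_tendsto_entangledSum_of_rankOne hU hk hα (fun _ => 1) B hB x y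
  simp only [one_mul] at hc1 hc2
  refine ⟨c, ?_⟩
  rw [tendsto_sup, tendsto_map'_iff, tendsto_map'_iff]
  exact ⟨hc2.congr fun F => (hL _ B).symm,
    hc1.congr fun N => ((hL _ B).trans (inner_smul_right _ _ _)).symm⟩
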